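/- Let $K$ be a field, $n\ge 0$, $A=(a_{i,j})_{1\le i,j\le n}$ an $n\times n$ matrix over $K$ with non-zero entries, and $\lambda=(\lambda_a)_{a\in\mathbb Z}$, $\mu=(\mu_a)_{a\in\mathbb Z}$ sequences in $K$. Let $(s^{\pm1}\lambda)_a=\lambda_{a\pm1}$, and let $A_{i_1,\dots,i_k}^{j_1,\dots,j_k}$ be $A$ with rows $i_1,\dots,i_k$ and columns $j_1,\dots,j_k$ erased. Define the generalized Lambda-determinant $|A|_{\lambda,\mu}$ as follows: the $0\times0$ matrix has value $1$, the $1\times1$ matrix $(a)$ has value $a$, and for $n\ge2$ $$|A|_{\lambda,\mu}=\frac{\mu_0\,|A_1^1|_{\lambda,s\mu}\,|A_n^n|_{\lambda,s^{-1}\mu}+\lambda_0\,|A_1^n|_{s^{-1}\lambda,\mu}\,|A_n^1|_{s\lambda,\mu}}{|A_{1,n}^{1,n}|_{\lambda,\mu}} .$$ Let $H$ be the space of formal combinations $\sum_{x,y}f(x,y)|x,y\rangle$ over $K$, $(x,y)\in\mathbb Z^2$, whose support is bounded below in $x$, with canonical basis vectors $|x,y\rangle$ and dual basis $\langle x,y|$.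 Let $\alpha:\mathbb Z^2\to K\setminus\{0\}$ be any function with $$\alpha_{x,y}=a_{\frac{x-y}2+n,\frac{x+y}2+1}\quad\text{on}\quad \mathcal D_n=\{(x,y)\in\mathbb Z^2: x+y\equiv0 \bmod 2,\ |x|+|y-n+1|\le n-1\}.$$ Let $\hat w|x,y\rangle=|x+1,y+1\rangle$, $\hat z|x,y\rangle=|x+1,y-1\rangle$, $\hat\alpha|x,y\rangle=\alpha_{x,y}|x,y\rangle$, $\hat\ell|x,y\rangle=\lambda_{y+1-n}|x,y\rangle$, $\hat m|x,y\rangle=\mu_x|x,y\rangle$, and $$T=\hat w\hat\ell+\hat w\hat m\hat\alpha^{-1}\hat z\hat\alpha+\hat\alpha^{-1}\hat z\hat\alpha .$$ Then: (1) $I-T$ is invertible on $H$. (2) Consider the directed network with vertex set $\mathcal D_n$ and the following edges between its vertices: $(x,y)\to(x+1,y+1)$ with weight $\lambda_{y+1-n}$, $(x,y)\to(x+2,y)$ with weight $\mu_{x+1}\alpha_{x,y}/\alpha_{x+1,y-1}$, and $(x,y)\to(x+1,y-1)$ with weight $\alpha_{x,y}/\alpha_{x+1,y-1}$. For $1\le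 i,j\le n$ let $Z_{i,j}$ be the sum, over the finitely many directed paths from $(1-i,i-1)$ to $(j-1,j-1)$, of the product of the weights of the traversed edges. Then $$Z_{i,j}=\langle0,0|\,\hat w^{1-j}(I-T)^{-1}\hat z^{1-i}\,|0,0\rangle .$$ (3) Whenever the recursive definition of $|A|_{\lambda,\mu}$ makes sense, i.e. no division by zero occurs in it, $$|A|_{\lambda,\mu}=\det_{1\le i,j\le n}\ \langle0,0|\,\hat w^{1-j}\,\hat\alpha\,\big(I-\hat w\hat\ell-\hat w\hat m\hat\alpha^{-1}\hat z\hat\alpha-\hat\alpha^{-1}\hat z\hat\alpha\big)^{-1}\hat z^{1-i}\,|0,0\rangle .$$ (4) In all cases, the Lambda-determinant of the matrix of indeterminates with indeterminate parameters, a rational function over $\mathbb Z$ in the $a_{i,j},\lambda_a,\mu_a$, is regular at the given point $(A,\lambda,\mu)$, and its value there is the determinant of part (3). -/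

import Mathlib

/-! ### The generalized Lambda-determinant -/

/-- The generalized Lambda-determinant of `A` with parameter sequences `lam`, `mu`, by the
inhomogeneous Dodgson condensation recursion. Erasing the first row or column is `Fin.succ`, erasing the last one is `Fin.castSucc`;
the sequence `fun a => mu (a + 1)` is the shift `s mu` and `fun a => mu (a - 1)` is `s⁻¹ mu`. -/
def lambdaDet {K : Type*} [Field K] :
    (n : ℕ) → (lam mu : ℤ → K) → Matrix (Fin n) (Fin n) K → K
  | 0, _, _, _ => 1
  | 1, _, _, A => A 0 0
  | n + 2, lam, mu, A =>
    (mu 0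
        * lambdaDet (n + 1) lam (fun a => mu (a + 1)) (A.submatrix Fin.succ Fin.succ)
        * lambdaDet (n + 1) lam (fun a => mu (a - 1)) (A.submatrix Fin.castSucc Fin.castSucc)
      + lam 0
        * lambdaDet (n + 1) (fun a => lam (a - 1)) mu (A.submatrix Fin.succ Fin.castSucc)
        * lambdaDet (n + 1) (fun a => lam (a + 1)) mu (A.submatrix Fin.castSucc Fin.succ))
      / lambdaDet n lam mu
          (A.submatrix (fun i => i.castSucc.succ) (fun i => i.castSucc.succ))

/-- The condensation recursion for `A` never divides by zero. -/
def CondensationDefined {K : Type*} [Field K] :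
    (n : ℕ) → (lam mu : ℤ → K) → Matrix (Fin n) (Fin n) K → Prop
  | 0, _, _, _ => True
  | 1, _, _, _ => True
  | n + 2, lam, mu, A =>
    CondensationDefined (n + 1) lam (fun a => mu (a + 1)) (A.submatrix Fin.succ Fin.succ) ∧
    CondensationDefined (n + 1) lam (fun a => mu (a - 1))
      (A.submatrix Fin.castSucc Fin.castSucc) ∧
    CondensationDefined (n + 1) (fun a => lam (a - 1)) mu
      (A.submatrix Fin.succ Fin.castSucc) ∧
    CondensationDefined (n + 1) (fun a => lam (a + 1)) mu
      (A.submatrix Fin.castSucc Fin.succ) ∧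
    CondensationDefined n lam mu
      (A.submatrix (fun i => i.castSucc.succ) (fun i => i.castSucc.succ)) ∧
    lambdaDet n lam mu
      (A.submatrix (fun i => i.castSucc.succ) (fun i => i.castSucc.succ)) ≠ 0

/-- Indeterminates: the entries of an `n × n` matrix, the `λ_a` and the `μ_a`, `a ∈ ℤ`. -/
abbrev LambdaVar (n : ℕ) : Type := (Fin n × Fin n) ⊕ (ℤ ⊕ ℤ)

/-- The field of rational functions over `ℚ` in these indeterminates, presented as the fraction
field of the polynomial ring with integer coefficients. -/
abbrev LambdaField (n : ℕ) : Type := FractionRing (MvPolynomial (LambdaVar n) ℤ)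

/-- The Lambda-determinant of the matrix of indeterminates, with indeterminate parameters. -/
noncomputable def genericLambdaDet (n : ℕ) : LambdaField n :=
  lambdaDet n
    (fun a => algebraMap (MvPolynomial (LambdaVar n) ℤ) (LambdaField n)
      (MvPolynomial.X (Sum.inr (Sum.inl a))))
    (fun a => algebraMap (MvPolynomial (LambdaVar n) ℤ) (LambdaField n)
      (MvPolynomial.X (Sum.inr (Sum.inr a))))
    (Matrix.of fun i j => algebraMap (MvPolynomial (LambdaVar n) ℤ) (LambdaField n)
      (MvPolynomial.X (Sum.inl (i, j))))

/-- The rational function `f` is regular at the point `p`, with value `d` there. -/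
def HasValueAt {σ K : Type*} [Field K] (f : FractionRing (MvPolynomial σ ℤ)) (p : σ → K)
    (d : K) : Prop :=
  ∃ N D : MvPolynomial σ ℤ, MvPolynomial.aeval p D ≠ 0 ∧
    f * algebraMap (MvPolynomial σ ℤ) (FractionRing (MvPolynomial σ ℤ)) D =
      algebraMap (MvPolynomial σ ℤ) (FractionRing (MvPolynomial σ ℤ)) N ∧
    d * MvPolynomial.aeval p D = MvPolynomial.aeval p N

/-- The point with coordinates the entries of `A` and the given parameters. -/
def lambdaPoint {K : Type*} (n : ℕ) (lam mu : ℤ → K) (A : Matrix (Fin n) (Fin n) K) :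
    LambdaVar n → K :=
  Sum.elim (fun v => A v.1 v.2) (Sum.elim lam mu)

/-! ### The space `H` and its operators -/

/-- The space `H` with canonical basis `|x,y⟩`, `(x,y) ∈ ℤ²`, completed so that `(I - T)⁻¹` makes
sense: `f` stands for the formal combination `∑ f (x,y) |x,y⟩`, and the combinations allowed are
those whose support is bounded below in the `x` direction. -/
def LatticeSpace (K : Type*) [Field K] : Submodule K (ℤ × ℤ → K) where
  carrier := {f | ∃ N : ℤ, ∀ v : ℤ × ℤ, v.1 < N → f v = 0}
  add_mem' := by
    rintro f g ⟨N, hN⟩ ⟨M, hM⟩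
    refine ⟨min N M, fun v hv => ?_⟩
    simp [hN v (lt_of_lt_of_le hv (min_le_left _ _)), hM v (lt_of_lt_of_le hv (min_le_right _ _))]
  zero_mem' := ⟨0, fun _ _ => rfl⟩
  smul_mem' := by
    rintro c f ⟨N, hN⟩
    exact ⟨N, fun v hv => by simp [hN v hv]⟩

/-- The basis vector `|v⟩`. -/
def ket (K : Type*) [Field K] (v : ℤ × ℤ) : LatticeSpace K :=
  ⟨Pi.single v 1, v.1, fun u hu => Pi.single_eq_of_ne (fun h => by simp [h] at hu) 1⟩

/-- The dual basis vector `⟨v|`, that is the coordinate of index `v`. -/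
def bra (K : Type*) [Field K] (v : ℤ × ℤ) : LatticeSpace K →ₗ[K] K :=
  (LinearMap.proj v).comp (LatticeSpace K).subtype

/-- The translation operator `|v⟩ ↦ |v + d⟩`. -/
def latticeTranslate (K : Type*) [Field K] (d : ℤ × ℤ) : LatticeSpace K ≃ₗ[K] LatticeSpace K where
  toFun f := ⟨fun v => f.1 (v - d), by
    obtain ⟨N, hN⟩ := f.2
    exact ⟨N + d.1, fun v hv => hN _ (by simp only [Prod.fst_sub]; omega)⟩⟩
  map_add' _ _ := rfl
  map_smul' _ _ := rfl
  invFun f := ⟨fun v => f.1 (v + d), by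
    obtain ⟨N, hN⟩ := f.2
    exact ⟨N - d.1, fun v hv => hN _ (by simp only [Prod.fst_add]; omega)⟩⟩
  left_inv f := by ext v; simp
  right_inv f := by ext v; simp

/-- The operator `ŵ : |x,y⟩ ↦ |x+1,y+1⟩`. -/
def wOp (K : Type*) [Field K] : LatticeSpace K ≃ₗ[K] LatticeSpace K := latticeTranslate K (1, 1)

/-- The operator `ẑ : |x,y⟩ ↦ |x+1,y-1⟩`. -/
def zOp (K : Type*) [Field K] : LatticeSpace K ≃ₗ[K] LatticeSpace K := latticeTranslate K (1, -1)

/-- The diagonal operator `|v⟩ ↦ c v |v⟩`. -/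
def diagOp {K : Type*} [Field K] (c : ℤ × ℤ → K) : Module.End K (LatticeSpace K) where
  toFun f := ⟨fun v => c v * f.1 v, by
    obtain ⟨N, hN⟩ := f.2
    exact ⟨N, fun v hv => by simp [hN v hv]⟩⟩
  map_add' f g := by ext v; simp [mul_add]
  map_smul' r f := by ext v; simp [mul_left_comm]

/-- The transfer operator `T = ŵ ℓ̂ + ŵ m̂ α̂⁻¹ ẑ α̂ + α̂⁻¹ ẑ α̂`, where `ℓ_{x,y} = λ_{y+1-n}` and
`m_{x,y} = μ_x`; it is used for a nowhere vanishing function `α`. -/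
def transferOp {K : Type*} [Field K] (n : ℕ) (lam mu : ℤ → K) (α : ℤ × ℤ → K) :
    Module.End K (LatticeSpace K) :=
  let w : Module.End K (LatticeSpace K) := (wOp K).toLinearMap
  let z : Module.End K (LatticeSpace K) := (zOp K).toLinearMap
  let l : Module.End K (LatticeSpace K) := diagOp fun v => lam (v.2 + 1 - n)
  let m : Module.End K (LatticeSpace K) := diagOp fun v => mu v.1
  let a : Module.End K (LatticeSpace K) := diagOp α
  let aInv : Module.End K (LatticeSpace K) := diagOp fun v => (α v)⁻¹
  w * l + w * m * aInv * z * a + aInv * z * a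

/-! ### The network and its path partition functions -/

/-- The vertex set
`𝒟_n = {(x,y) ∈ ℤ² : x + y = 0 mod 2, |x| + |y - n + 1| ≤ n - 1}`. -/
def networkVertices (n : ℕ) : Set (ℤ × ℤ) :=
  {v | Even (v.1 + v.2) ∧ |v.1| + |v.2 - n + 1| ≤ (n : ℤ) - 1}

/-- The three kinds of directed edges of the triangular lattice. -/
inductive NetStep : Type
  | up
  | flat
  | down

/-- The displacement along an edge. -/
def NetStep.disp : NetStep → ℤ × ℤ
  | .up => (1, 1)
  | .flat => (2, 0)
  | .down => (1, -1)

/-- The weight of the edge of the given kind that starts at `v`. -/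
def NetStep.weight {K : Type*} [Field K] (n : ℕ) (lam mu : ℤ → K) (α : ℤ × ℤ → K)
    (v : ℤ × ℤ) : NetStep → K
  | .up => lam (v.2 + 1 - n)
  | .flat => mu (v.1 + 1) * (α v / α (v + (1, -1)))
  | .down => α v / α (v + (1, -1))

/-- `IsNetPath n u e p`: the sequence of steps `p` leads from `u` to `e`, and all the vertices
visited, `u` and `e` included, lie in `networkVertices n`. -/
def IsNetPath (n : ℕ) : (u e : ℤ × ℤ) → List NetStep → Prop
  | u, e, [] => u ∈ networkVertices n ∧ u = e
  | u, e, s :: p => u ∈ networkVertices n ∧ IsNetPath n (u + s.disp) e p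

/-- The product of the weights of the edges traversed by a path that starts at `u`. -/
def netPathWeight {K : Type*} [Field K] (n : ℕ) (lam mu : ℤ → K) (α : ℤ × ℤ → K) :
    (u : ℤ × ℤ) → List NetStep → K
  | _, [] => 1
  | u, s :: p => s.weight n lam mu α u * netPathWeight n lam mu α (u + s.disp) p

/-- The partition function for paths from `u` to `e`: the sum of their weights. -/
noncomputable def netPartition {K : Type*} [Field K] (n : ℕ) (lam mu : ℤ → K)
    (α : ℤ × ℤ → K) (u e : ℤ × ℤ) : K :=
  ∑ᶠ p ∈ {p : List NetStep | IsNetPath n u e p}, netPathWeight n lam mu α u p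

/-! ### Determinant identities -/

section Determinants

variable {R : Type*} [CommRing R]

/-- Jacobi's complementary minor formula for a minor of size two of the adjugate. -/
theorem det_mul_det_toBlocks_adjugate {m : Type*} [Fintype m] [DecidableEq m]
    (A : Matrix (Fin 2 ⊕ m) (Fin 2 ⊕ m) R) :
    A.det * A.adjugate.toBlocks₁₁.det = A.det * (A.det * A.toBlocks₂₂.det) := by
  have h : A * Matrix.fromBlocks A.adjugate.toBlocks₁₁ 0 A.adjugate.toBlocks₂₁ 1 =
      Matrix.fromBlocks (A.det • 1) A.toBlocks₁₂ 0 A.toBlocks₂₂ := by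
    have h1 := A.mul_adjugate
    rw [← Matrix.fromBlocks_toBlocks A, ← Matrix.fromBlocks_toBlocks (Matrix.adjugate _),
      Matrix.fromBlocks_multiply, ← Matrix.fromBlocks_one, Matrix.fromBlocks_smul,
      Matrix.fromBlocks_inj] at h1
    simp only [Matrix.fromBlocks_toBlocks] at h1
    have h2 := Matrix.fromBlocks_multiply A.toBlocks₁₁ A.toBlocks₁₂ A.toBlocks₂₁ A.toBlocks₂₂
      A.adjugate.toBlocks₁₁ (0 : Matrix (Fin 2) m R) A.adjugate.toBlocks₂₁ 1
    rw [Matrix.fromBlocks_toBlocks] at h2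
    rw [h2, h1.1, h1.2.2.1]
    simp
  have h2 := congrArg Matrix.det h
  rw [Matrix.det_mul, Matrix.det_fromBlocks_zero₁₂, Matrix.det_fromBlocks_zero₂₁,
    Matrix.det_smul] at h2
  simpa [sq, mul_assoc] using h2

theorem det_toBlocks_adjugate {m : Type*} [Fintype m] [DecidableEq m]
    (A : Matrix (Fin 2 ⊕ m) (Fin 2 ⊕ m) R) :
    A.adjugate.toBlocks₁₁.det = A.det * A.toBlocks₂₂.det := by
  have h := mul_left_cancel₀ (Matrix.det_mvPolynomialX_ne_zero (Fin 2 ⊕ m) ℤ)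
    (det_mul_det_toBlocks_adjugate (Matrix.mvPolynomialX (Fin 2 ⊕ m) (Fin 2 ⊕ m) ℤ))
  have h2 := congrArg (MvPolynomial.eval₂Hom (Int.castRingHom R)
    (fun p : (Fin 2 ⊕ m) × (Fin 2 ⊕ m) => A p.1 p.2)) h
  have hA : (Matrix.mvPolynomialX (Fin 2 ⊕ m) (Fin 2 ⊕ m) ℤ).map
      (MvPolynomial.eval₂Hom (Int.castRingHom R) fun p => A p.1 p.2) = A :=
    Matrix.mvPolynomialX_map_eval₂ _ A
  rw [map_mul, RingHom.map_det, RingHom.map_det, RingHom.map_det] at h2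
  have e1 := RingHom.map_adjugate (MvPolynomial.eval₂Hom (Int.castRingHom R)
    fun p : (Fin 2 ⊕ m) × (Fin 2 ⊕ m) => A p.1 p.2) (Matrix.mvPolynomialX _ _ ℤ)
  simp only [RingHom.mapMatrix_apply] at h2 e1
  rw [hA] at h2 e1
  rw [← e1]
  nth_rw 3 [← hA]
  exact h2

/-- The Desnanot–Jacobi identity. -/
theorem desnanot_jacobi (k : ℕ) (A : Matrix (Fin (k + 2)) (Fin (k + 2)) R) :
    A.det * (A.submatrix (fun i : Fin k => i.castSucc.succ) fun i => i.castSucc.succ).det =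
      (A.submatrix Fin.succ Fin.succ).det * (A.submatrix Fin.castSucc Fin.castSucc).det -
      (A.submatrix Fin.succ Fin.castSucc).det * (A.submatrix Fin.castSucc Fin.succ).det := by
  let f : Fin 2 ⊕ Fin k → Fin (k + 2) :=
    Sum.elim ![0, Fin.last (k + 1)] fun i => i.castSucc.succ
  have hf : Function.Bijective f := by
    rw [Fintype.bijective_iff_injective_and_card]
    refine ⟨?_, by simp [add_comm]⟩
    rintro (a | a) (b | b) h
    · fin_cases a <;> fin_cases b <;> simp_all [f, Fin.ext_iff]
    · have := b.2
      fin_cases a <;> simp [f, Fin.ext_iff] at h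
      omega
    · have := a.2
      fin_cases b <;> simp [f, Fin.ext_iff] at h
      omega
    · simp only [f, Sum.elim_inr, Fin.ext_iff, Fin.val_succ, Fin.val_castSucc] at h
      exact congrArg _ (Fin.ext (by omega))
  let e := Equiv.ofBijective f hf
  have h := det_toBlocks_adjugate (A.submatrix e e)
  rw [Matrix.adjugate_submatrix_equiv_self, Matrix.det_submatrix_equiv_self] at h
  have h22 : (A.submatrix e e).toBlocks₂₂ =
      A.submatrix (fun i : Fin k => i.castSucc.succ) fun i => i.castSucc.succ := rfl
  rw [h22] at h
  rw [← h, Matrix.det_fin_two]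
  simp only [Matrix.toBlocks₁₁, Matrix.of_apply, Matrix.submatrix_apply, e, f,
    Equiv.ofBijective_apply, Sum.elim_inl, Matrix.cons_val_zero, Matrix.cons_val_one,
    Matrix.adjugate_fin_succ_eq_det_submatrix, Fin.succAbove_zero, Fin.succAbove_last]
  have hs : ((-1 : R) ^ (k + 1)) * (-1) ^ (k + 1) = 1 := by
    rw [← mul_pow]; simp
  have hs2 : ((-1 : R) ^ (k + 1 + (k + 1))) = 1 := by rw [pow_add, hs]
  simp only [Fin.val_zero, Fin.val_last, add_zero, zero_add, pow_zero, one_mul, hs2]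
  linear_combination (-(A.submatrix Fin.succ Fin.castSucc).det *
    (A.submatrix Fin.castSucc Fin.succ).det) * hs

/-- Rows that arise from the rows of `M'` by a lower bidiagonal recursion. -/
theorem det_of_bidiagonal_rows {K : Type*} [Field K] (k : ℕ) (M M' : ℕ → Fin k → K)
    (l p q : ℕ → K) (hl : ∀ m, l m ≠ 0) (h0 : ∀ c, M 0 c = l 0 * M' 0 c)
    (hs : ∀ m c, M (m + 1) c = p m * M m c + l (m + 1) * M' (m + 1) c + q m * M' m c) :
    (Matrix.of fun (i j : Fin k) => M i j).det =
      (∏ i : Fin k, l i) * (Matrix.of fun (i j : Fin k) => M' i j).det := by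
  cases k with
  | zero => simp
  | succ k =>
    rw [← Matrix.det_mul_column]
    let X : Matrix (Fin (k + 1)) (Fin (k + 1)) K := Fin.cons (fun c => l 0 * M' 0 c)
      fun (m : Fin k) c => l (m + 1) * M' (m + 1) c + q m * M' m c
    trans X.det
    · apply Matrix.det_eq_of_forall_row_eq_smul_add_pred fun i => p i
      · intro j; simp [X, h0]
      · intro i j; simp [X, hs]; ring
    · symm
      apply Matrix.det_eq_of_forall_row_eq_smul_add_pred fun i => -(q i / l i)
      · intro j; simp [X]
      · intro i j
        have := hl i
        simp [X]; field_simp; ring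

end Determinants

/-! ### The resolvent of the transfer operator -/

section Resolvent

variable {K : Type*} [Field K]

theorem transferOp_apply (n : ℕ) (lam mu : ℤ → K) (α : ℤ × ℤ → K) (f : LatticeSpace K)
    (v : ℤ × ℤ) :
    (transferOp n lam mu α f).1 v =
      lam (v.2 - n) * f.1 (v - (1, 1)) +
      mu (v.1 - 1) * (α (v - (2, 0)) / α (v - (1, 1))) * f.1 (v - (2, 0)) +
      α (v - (1, -1)) / α v * f.1 (v - (1, -1)) := by
  have h : (transferOp n lam mu α f).1 v =
      lam ((v - (1, 1)).2 + 1 - n) * f.1 (v - (1, 1)) +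
      mu (v - (1, 1)).1 * ((α (v - (1, 1)))⁻¹ *
        (α (v - (1, 1) - (1, -1)) * f.1 (v - (1, 1) - (1, -1)))) +
      (α v)⁻¹ * (α (v - (1, -1)) * f.1 (v - (1, -1))) := rfl
  have h2 : v - (1, 1) - (1, -1) = v - (2, 0) := by
    ext <;> simp
    omega
  rw [h, h2, Prod.snd_sub, Prod.fst_sub, sub_add_cancel]
  ring

theorem ket_apply (u v : ℤ × ℤ) : (ket K u).1 v = if u = v then 1 else 0 := by
  simp [ket, Pi.single_apply, eq_comm]

theorem transferOp_ket (n : ℕ) (lam mu : ℤ → K) (α : ℤ × ℤ → K) (u : ℤ × ℤ) :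
    transferOp n lam mu α (ket K u) =
      NetStep.up.weight n lam mu α u • ket K (u + NetStep.up.disp) +
      NetStep.flat.weight n lam mu α u • ket K (u + NetStep.flat.disp) +
      NetStep.down.weight n lam mu α u • ket K (u + NetStep.down.disp) := by
  ext v
  rw [transferOp_apply]
  simp only [Submodule.coe_add, Submodule.coe_smul, Pi.add_apply, Pi.smul_apply, ket_apply,
    smul_eq_mul, NetStep.weight, NetStep.disp, eq_sub_iff_add_eq]
  congr 1
  · congr 1
    · split_ifs with h
      · rw [← h]; simp only [Prod.snd_add]
      · simp
    · split_ifs with h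
      · have h1 : v - (2, 0) = u := by rw [← h]; simp
        have h2 : v - (1, 1) = u + (1, -1) := by
          rw [← h]; ext <;> simp <;> ring
        have h3 : v.1 - 1 = u.1 + 1 := by rw [← h]; simp; ring
        rw [h1, h2, h3]
      · simp
  · split_ifs with h
    · have h1 : v - (1, -1) = u := by rw [← h]; simp
      rw [h1, h]
    · simp

theorem transferOp_apply_eq_zero (n : ℕ) (lam mu : ℤ → K) (α : ℤ × ℤ → K) (f : LatticeSpace K)
    (N : ℤ) (hf : ∀ v : ℤ × ℤ, v.1 < N → f.1 v = 0) (v : ℤ × ℤ) (hv : v.1 < N + 1) :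
    (transferOp n lam mu α f).1 v = 0 := by
  rw [transferOp_apply, hf, hf, hf]
  · ring
  all_goals simp only [Prod.fst_sub]; omega

theorem transferOp_pow_apply_eq_zero (n : ℕ) (lam mu : ℤ → K) (α : ℤ × ℤ → K)
    (f : LatticeSpace K) (N : ℤ) (hf : ∀ v : ℤ × ℤ, v.1 < N → f.1 v = 0) (k : ℕ) (v : ℤ × ℤ)
    (hv : v.1 < N + k) : ((transferOp n lam mu α ^ k) f).1 v = 0 := by
  induction k generalizing v with
  | zero => exact hf v (by simpa using hv)
  | succ k ih =>
    rw [pow_succ']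
    exact transferOp_apply_eq_zero n lam mu α _ (N + k) ih v (by push_cast at hv; omega)

theorem isUnit_one_sub_transferOp (n : ℕ) (lam mu : ℤ → K) (α : ℤ × ℤ → K) :
    IsUnit (1 - transferOp n lam mu α) := by
  rw [Module.End.isUnit_iff]
  set T := transferOp n lam mu α with hT
  constructor
  · rw [← LinearMap.ker_eq_bot, LinearMap.ker_eq_bot']
    intro f hf
    have hTf : T f = f := (sub_eq_zero.mp (by simpa using hf)).symm
    obtain ⟨N, hN⟩ := f.2
    have key : ∀ k : ℕ, (T ^ k) f = f := fun k => by
      induction k with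
      | zero => rfl
      | succ k ih => rw [pow_succ, Module.End.mul_apply, hTf, ih]
    ext v
    have := transferOp_pow_apply_eq_zero n lam mu α f N hN (v.1 - N + 1).toNat v (by omega)
    rw [← hT, key] at this
    simpa using this
  · intro f
    obtain ⟨N, hN⟩ := f.2
    let S : ℕ → LatticeSpace K := fun M => ∑ k ∈ Finset.range M, (T ^ k) f
    have hS : ∀ M v, v.1 < N → (S M).1 v = 0 := fun M v hv => by
      simp only [S, Submodule.coe_sum, Finset.sum_apply]
      exact Finset.sum_eq_zero fun k _ =>
        transferOp_pow_apply_eq_zero n lam mu α f N hN k v (by omega)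
    have hstab : ∀ (v : ℤ × ℤ) (M M' : ℕ), v.1 < N + M → M ≤ M' → (S M').1 v = (S M).1 v := by
      intro v M M' hv h
      induction M', h using Nat.le_induction with
      | base => rfl
      | succ M' h ih =>
        rw [← ih]
        simp only [S, Finset.sum_range_succ, Submodule.coe_add, Pi.add_apply]
        rw [transferOp_pow_apply_eq_zero n lam mu α f N hN M' v (by omega), add_zero]
    let F : LatticeSpace K := ⟨fun v => (S (v.1 - N + 1).toNat).1 v, N, fun v hv => hS _ v hv⟩
    refine ⟨F, ?_⟩
    ext v
    let M := (v.1 - N + 1).toNat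
    have h1 : ∀ u : ℤ × ℤ, u.1 < v.1 + 1 → (F - S M).1 u = 0 := by
      intro u hu
      have : F.1 u = (S M).1 u := (hstab u _ M (by omega) (by omega)).symm
      simp [this]
    have h2 : (T F).1 v = (T (S M)).1 v := by
      have h := transferOp_apply_eq_zero n lam mu α (F - S M) (v.1 + 1) h1 v (by omega)
      rw [map_sub] at h
      exact sub_eq_zero.mp h
    have h3 : S M - T (S M) = f - (T ^ M) f := by
      have := congrArg (fun g : Module.End K (LatticeSpace K) => g f) (mul_neg_geom_sum T M)
      simpa [S, LinearMap.sum_apply] using this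
    have h4 := congrArg (fun g : LatticeSpace K => g.1 v) h3
    have h5 : ((T ^ M) f).1 v = 0 :=
      transferOp_pow_apply_eq_zero n lam mu α f N hN M v (by omega)
    simp only [AddSubgroupClass.coe_sub, Pi.sub_apply, h5, sub_zero] at h4
    have h6 : ((1 - T) F).1 v = F.1 v - (T F).1 v := rfl
    exact h6.trans (by rw [h2]; exact h4)

/-- The matrix elements of the resolvent `(I - T)⁻¹`. -/
noncomputable def green (n : ℕ) (lam mu : ℤ → K) (α : ℤ × ℤ → K) (u v : ℤ × ℤ) : K :=
  bra K v (Ring.inverse (1 - transferOp n lam mu α) (ket K u))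

theorem green_eq_first_step (n : ℕ) (lam mu : ℤ → K) (α : ℤ × ℤ → K) (u v : ℤ × ℤ) :
    green n lam mu α u v = (if u = v then 1 else 0) +
      (NetStep.up.weight n lam mu α u * green n lam mu α (u + NetStep.up.disp) v +
      NetStep.flat.weight n lam mu α u * green n lam mu α (u + NetStep.flat.disp) v +
      NetStep.down.weight n lam mu α u * green n lam mu α (u + NetStep.down.disp) v) := by
  have h := congrArg (fun g : Module.End K (LatticeSpace K) => bra K v (g (ket K u)))
    (Ring.inverse_mul_cancel _ (isUnit_one_sub_transferOp n lam mu α))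
  simp only [Module.End.mul_apply, LinearMap.sub_apply, Module.End.one_apply, transferOp_ket,
    map_sub, map_add, map_smul, smul_eq_mul] at h
  have h2 : bra K v (ket K u) = if u = v then 1 else 0 := ket_apply u v
  rw [h2, sub_eq_iff_eq_add] at h
  exact h

theorem green_eq_last_step (n : ℕ) (lam mu : ℤ → K) (α : ℤ × ℤ → K) (u v : ℤ × ℤ) :
    green n lam mu α u v = (if u = v then 1 else 0) +
      (lam (v.2 - n) * green n lam mu α u (v - (1, 1)) +
      mu (v.1 - 1) * (α (v - (2, 0)) / α (v - (1, 1))) * green n lam mu α u (v - (2, 0)) +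
      α (v - (1, -1)) / α v * green n lam mu α u (v - (1, -1))) := by
  have h := congrArg (fun g : Module.End K (LatticeSpace K) => (g (ket K u)).1 v)
    (Ring.mul_inverse_cancel _ (isUnit_one_sub_transferOp n lam mu α))
  simp only [Module.End.mul_apply, LinearMap.sub_apply, Module.End.one_apply,
    AddSubgroupClass.coe_sub, Pi.sub_apply, transferOp_apply, ket_apply, sub_eq_iff_eq_add] at h
  exact h

theorem green_eq_zero (n : ℕ) (lam mu : ℤ → K) (α : ℤ × ℤ → K) (u v : ℤ × ℤ)
    (h : v.1 - u.1 < |v.2 - u.2|) : green n lam mu α u v = 0 := by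
  obtain ⟨N, hN⟩ := (Ring.inverse (1 - transferOp n lam mu α) (ket K u)).2
  have key : ∀ (m : ℕ) (v : ℤ × ℤ), v.1 < N + m → v.1 - u.1 < |v.2 - u.2| →
      green n lam mu α u v = 0 := by
    intro m
    induction m with
    | zero => exact fun v hv _ => hN v (by simpa using hv)
    | succ m ih =>
      intro v hv h
      have huv : u ≠ v := by rintro rfl; simp at h
      rw [green_eq_last_step, if_neg huv, ih, ih, ih]
      · ring
      all_goals simp only [Prod.fst_sub, Prod.snd_sub]
      all_goals first | omega | (rw [lt_abs] at h ⊢; omega)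
  exact key (v.1 - N + 1).toNat v (by omega) h

theorem green_self (n : ℕ) (lam mu : ℤ → K) (α : ℤ × ℤ → K) (u : ℤ × ℤ) :
    green n lam mu α u u = 1 := by
  rw [green_eq_last_step, if_pos rfl, green_eq_zero, green_eq_zero, green_eq_zero]
  · ring
  all_goals simp

end Resolvent

/-! ### Determinants of the resolvent and the octahedron relation -/

section Octahedron

variable {K : Type*} [Field K]

/-- The lattice point that carries the matrix entry in row `r` and column `c`, both counted
from `0`. -/
def latticePos (n : ℕ) (r c : ℤ) : ℤ × ℤ := (r + c + 1 - n, c - r + n - 1)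

/-- The matrix elements of `α̂ (I - T)⁻¹` between the lattice points of two matrix entries. -/
noncomputable def entryGreen (n : ℕ) (lam mu : ℤ → K) (α : ℤ × ℤ → K) (s j r c : ℤ) : K :=
  α (latticePos n r c) * green n lam mu α (latticePos n s j) (latticePos n r c)

theorem latticePos_inj {n : ℕ} {s j r c : ℤ} :
    latticePos n s j = latticePos n r c ↔ s = r ∧ j = c := by
  simp only [latticePos, Prod.mk.injEq]; omega

theorem green_latticePos_eq_zero (n : ℕ) (lam mu : ℤ → K) (α : ℤ × ℤ → K) {s j r c : ℤ}
    (h : r < s ∨ c < j) : green n lam mu α (latticePos n s j) (latticePos n r c) = 0 := by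
  apply green_eq_zero
  simp only [latticePos, lt_abs]; omega

theorem green_latticePos_first_step (n : ℕ) (lam mu : ℤ → K) (α : ℤ × ℤ → K) (s j r c : ℤ) :
    green n lam mu α (latticePos n s j) (latticePos n r c) =
      (if s = r ∧ j = c then 1 else 0) +
      (lam (j - s) * green n lam mu α (latticePos n s (j + 1)) (latticePos n r c) +
      mu (s + j + 2 - n) * (α (latticePos n s j) / α (latticePos n (s + 1) j)) *
        green n lam mu α (latticePos n (s + 1) (j + 1)) (latticePos n r c) +
      α (latticePos n s j) / α (latticePos n (s + 1) j) *
        green n lam mu α (latticePos n (s + 1) j) (latticePos n r c)) := by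
  rw [green_eq_first_step]
  simp only [latticePos_inj, NetStep.weight, NetStep.disp]
  have h1 : latticePos n s j + (1, 1) = latticePos n s (j + 1) := by
    ext <;> simp only [latticePos, Prod.fst_add, Prod.snd_add] <;> ring
  have h2 : latticePos n s j + (2, 0) = latticePos n (s + 1) (j + 1) := by
    ext <;> simp only [latticePos, Prod.fst_add, Prod.snd_add] <;> ring
  have h3 : latticePos n s j + (1, -1) = latticePos n (s + 1) j := by
    ext <;> simp only [latticePos, Prod.fst_add, Prod.snd_add] <;> ring
  have h4 : (latticePos n s j).2 + 1 - n = j - s := by simp only [latticePos]; ring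
  have h5 : (latticePos n s j).1 + 1 = s + j + 2 - n := by simp only [latticePos]; ring
  rw [h1, h2, h3, h4, h5]

variable {n : ℕ} {lam mu : ℤ → K} {α : ℤ × ℤ → K}

theorem entryGreen_eq_zero {s j r c : ℤ} (h : r < s ∨ c < j) :
    entryGreen n lam mu α s j r c = 0 := by
  rw [entryGreen, green_latticePos_eq_zero n lam mu α h, mul_zero]

theorem entryGreen_self (s j : ℤ) : entryGreen n lam mu α s j s j = α (latticePos n s j) := by
  rw [entryGreen, green_self, mul_one]

theorem entryGreen_first_step {s j r c : ℤ} (h : ¬(s = r ∧ j = c)) :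
    entryGreen n lam mu α s j r c =
      lam (j - s) * entryGreen n lam mu α s (j + 1) r c +
      mu (s + j + 2 - n) * (α (latticePos n s j) / α (latticePos n (s + 1) j)) *
        entryGreen n lam mu α (s + 1) (j + 1) r c +
      α (latticePos n s j) / α (latticePos n (s + 1) j) *
        entryGreen n lam mu α (s + 1) j r c := by
  rw [entryGreen, green_latticePos_first_step, if_neg h]
  simp only [entryGreen]; ring

theorem entryGreen_last_step (hα0 : ∀ v, α v ≠ 0) {s j r c : ℤ} (h : ¬(s = r ∧ j = c)) :
    entryGreen n lam mu α s j r c =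
      lam (c - 1 - r) * (α (latticePos n r c) / α (latticePos n r (c - 1))) *
        entryGreen n lam mu α s j r (c - 1) +
      mu (r + c - n) * (α (latticePos n r c) / α (latticePos n r (c - 1))) *
        entryGreen n lam mu α s j (r - 1) (c - 1) +
      entryGreen n lam mu α s j (r - 1) c := by
  rw [entryGreen, green_eq_last_step, if_neg fun e => h (latticePos_inj.mp e)]
  have h1 : latticePos n r c - (1, 1) = latticePos n r (c - 1) := by
    ext <;> simp only [latticePos, Prod.fst_sub, Prod.snd_sub] <;> ring
  have h2 : latticePos n r c - (2, 0) = latticePos n (r - 1) (c - 1) := by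
    ext <;> simp only [latticePos, Prod.fst_sub, Prod.snd_sub] <;> ring
  have h3 : latticePos n r c - (1, -1) = latticePos n (r - 1) c := by
    ext <;> simp only [latticePos, Prod.fst_sub, Prod.snd_sub] <;> ring
  have h4 : (latticePos n r c).2 - n = c - 1 - r := by simp only [latticePos]; ring
  have h5 : (latticePos n r c).1 - 1 = r + c - n := by simp only [latticePos]; ring
  rw [h1, h2, h3, h4, h5]
  simp only [entryGreen]
  have := hα0 (latticePos n r c)
  have := hα0 (latticePos n r (c - 1))
  field_simp
  ring

variable (n lam mu α)

/-- The determinant attached to the `k × k` block of consecutive rows and columns with bottom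
row `r` and left column `j`. -/
noncomputable def blockDet (k : ℕ) (r j : ℤ) : K :=
  (Matrix.of fun m m' : Fin k => entryGreen n lam mu α (r - (m : ℕ)) j r (j + (m' : ℕ))).det

/-- The rows of a matrix whose determinant is `blockDet`, with sources and targets of the block
above the bottom row `r`. -/
noncomputable def condensedRow (r j : ℤ) : ℕ → ℕ → K
  | 0, c => (-1) ^ c * α (latticePos n r (j + c)) *
      ∏ t ∈ Finset.range c, mu (r + j + 1 + t - n)
  | m + 1, c => entryGreen n lam mu α (r - 1 - m) j (r - 1) (j + c)

variable {n lam mu α}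

theorem blockDet_succ (hα0 : ∀ v, α v ≠ 0) (k : ℕ) (r j : ℤ) :
    blockDet n lam mu α (k + 1) r j =
      (Matrix.of fun m m' : Fin (k + 1) => condensedRow n lam mu α r j m m').det := by
  let ρ : ℤ → K := fun c => α (latticePos n r (j + c + 1)) / α (latticePos n r (j + c))
  let N : Matrix (Fin (k + 1)) (Fin (k + 1)) K :=
    Matrix.of fun m m' => condensedRow n lam mu α r j m m'
  let X : Matrix (Fin (k + 1)) (Fin (k + 1)) K := fun m =>
    Fin.cons (N m 0) fun c : Fin k =>
      N m c.succ + mu (r + (j + (c : ℕ) + 1) - n) * ρ (c : ℕ) * N m c.castSucc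
  have hX : N.det = X.det := by
    apply Matrix.det_eq_of_forall_col_eq_smul_add_pred
      fun c : Fin k => -(mu (r + (j + (c : ℕ) + 1) - n) * ρ (c : ℕ))
    · intro i; simp [X]
    · intro i c; simp only [X, Fin.cons_succ]; ring
  change _ = N.det
  rw [hX, blockDet]
  apply Matrix.det_eq_of_forall_col_eq_smul_add_pred
    fun c : Fin k => lam (j + (c : ℕ) - r) * ρ (c : ℕ)
  · intro m
    simp only [Matrix.of_apply, X, Fin.cons_zero, N, Fin.val_zero, Nat.cast_zero, add_zero]
    induction m using Fin.cases with
    | zero => simp [condensedRow, entryGreen_self]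
    | succ m =>
      simp only [Fin.val_succ, condensedRow, Nat.cast_zero, add_zero]
      rw [entryGreen_last_step hα0 (by push_cast; omega),
        entryGreen_eq_zero (c := j - 1) (by omega), entryGreen_eq_zero (c := j - 1) (by omega)]
      rw [show r - ((m + 1 : ℕ) : ℤ) = r - 1 - (m : ℕ) by push_cast; ring]
      ring
  · intro m c
    simp only [Matrix.of_apply, X, Fin.cons_succ, N, Fin.val_succ, Fin.val_castSucc]
    have e1 : j + ((c + 1 : ℕ) : ℤ) = j + (c : ℕ) + 1 := by push_cast; ring
    rw [e1, entryGreen_last_step hα0 (by omega)]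
    rw [show j + ((c : ℕ) : ℤ) + 1 - 1 = j + (c : ℕ) by ring]
    induction m using Fin.cases with
    | zero =>
      simp only [Fin.val_zero, condensedRow, e1, Finset.prod_range_succ]
      rw [entryGreen_eq_zero (r := r - 1) (by simp), entryGreen_eq_zero (r := r - 1) (by simp)]
      rw [show r + j + 1 + ((c : ℕ) : ℤ) - n = r + (j + (c : ℕ) + 1) - n by ring]
      have := hα0 (latticePos n r (j + (c : ℕ)))
      simp only [ρ]
      field_simp
      ring
    | succ m =>
      simp only [Fin.val_succ, condensedRow, e1, ρ]
      rw [show r - ((m + 1 : ℕ) : ℤ) = r - 1 - (m : ℕ) by push_cast; ring]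
      ring

theorem det_entryGreen_shift (hlam : ∀ a, lam a ≠ 0) (k : ℕ) (r j : ℤ) :
    (Matrix.of fun m m' : Fin k =>
      entryGreen n lam mu α (r - (m : ℕ)) j r (j + 1 + (m' : ℕ))).det =
      (∏ m : Fin k, lam (j - (r - (m : ℕ)))) * blockDet n lam mu α k r (j + 1) := by
  let ρ : ℤ → K := fun s => α (latticePos n s j) / α (latticePos n (s + 1) j)
  refine det_of_bidiagonal_rows k
    (fun m c => entryGreen n lam mu α (r - (m : ℕ)) j r (j + 1 + (c : ℕ)))
    (fun m c => entryGreen n lam mu α (r - (m : ℕ)) (j + 1) r (j + 1 + (c : ℕ)))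
    (fun m => lam (j - (r - m))) (fun m => ρ (r - 1 - m))
    (fun m => mu (r - 1 - m + j + 2 - n) * ρ (r - 1 - m)) (fun m => hlam _) ?_ ?_
  · intro c
    rw [entryGreen_first_step (by omega), entryGreen_eq_zero (s := r - (0 : ℕ) + 1) (by simp),
      entryGreen_eq_zero (s := r - (0 : ℕ) + 1) (by simp)]
    ring
  · intro m c
    rw [entryGreen_first_step (by omega)]
    rw [show r - ((m + 1 : ℕ) : ℤ) = r - 1 - m by push_cast; ring,
      show r - 1 - (m : ℤ) + 1 = r - m by ring]
    simp only [ρ, show r - 1 - (m : ℤ) + 1 = r - m by ring]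
    ring

theorem det_condensedRow_shift (hα0 : ∀ v, α v ≠ 0) (hlam : ∀ a, lam a ≠ 0) (k : ℕ) (r j : ℤ) :
    (Matrix.of fun m m' : Fin (k + 1) => condensedRow n lam mu α r j m (m' + 1)).det =
      -mu (r + j + 1 - n) * (∏ m : Fin k, lam (j - (r - 1 - (m : ℕ)))) *
        blockDet n lam mu α (k + 1) r (j + 1) := by
  let ρ : ℤ → K := fun s => α (latticePos n s j) / α (latticePos n (s + 1) j)
  let d : ℕ → K := fun m => if m = 0 then -mu (r + j + 1 - n) else 1
  let l : ℕ → K := fun m => Nat.casesOn m 1 fun m => lam (j - (r - 1 - m))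
  have hcast : ∀ c : ℕ, j + ((c + 1 : ℕ) : ℤ) = j + 1 + c := fun c => by push_cast; ring
  have h0 : ∀ c : ℕ, condensedRow n lam mu α r j 0 (c + 1) =
      -mu (r + j + 1 - n) * condensedRow n lam mu α r (j + 1) 0 c := fun c => by
    simp only [condensedRow, hcast, Finset.prod_range_succ', Nat.cast_zero, add_zero]
    rw [Finset.prod_congr rfl fun (t : ℕ) _ =>
      show mu (r + j + 1 + ((t + 1 : ℕ) : ℤ) - n) = mu (r + (j + 1) + 1 + (t : ℤ) - n) by
        push_cast; ring_nf]
    ring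
  have h := det_of_bidiagonal_rows (k + 1)
    (fun m c => condensedRow n lam mu α r j m (c + 1))
    (fun m c => d m * condensedRow n lam mu α r (j + 1) m c) l
    (fun m => Nat.casesOn m 0 fun m => ρ (r - 1 - 1 - m))
    (fun m => Nat.casesOn m 0 fun m => mu (r - 1 - 1 - m + j + 2 - n) * ρ (r - 1 - 1 - m))
    (fun m => by cases m <;> simp [l, hlam]) (fun c => by simp [l, d, h0]) ?_
  · have h2 := Matrix.det_mul_column (fun m : Fin (k + 1) => d m)
      (Matrix.of fun m m' : Fin (k + 1) => condensedRow n lam mu α r (j + 1) m m')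
    simp only [Matrix.of_apply] at h2
    rw [h, h2, Fin.prod_univ_succ, Fin.prod_univ_succ, blockDet_succ hα0]
    simp [l, d]
    ring
  · intro m c
    simp only [condensedRow, hcast]
    cases m with
    | zero =>
      simp only [Nat.cast_zero, sub_zero, l, d]
      rw [entryGreen_first_step (by omega), entryGreen_eq_zero (s := r - 1 + 1) (by simp),
        entryGreen_eq_zero (s := r - 1 + 1) (by simp)]
      simp
    | succ m =>
      rw [entryGreen_first_step (by omega)]
      simp only [l, d, hcast]
      rw [show r - 1 - ((m + 1 : ℕ) : ℤ) = r - 1 - 1 - m by push_cast; ring]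
      simp only [ρ, show r - 1 - 1 - (m : ℤ) + 1 = r - 1 - m by ring, Nat.add_eq_zero_iff,
        one_ne_zero, and_false, if_false]
      ring

/-- The octahedron relation. -/
theorem blockDet_octahedron (hα0 : ∀ v, α v ≠ 0) (hlam : ∀ a, lam a ≠ 0) (k : ℕ) (r j : ℤ) :
    blockDet n lam mu α (k + 2) r j * blockDet n lam mu α k (r - 1) (j + 1) =
      mu (r + j + 1 - n) * blockDet n lam mu α (k + 1) r (j + 1) *
        blockDet n lam mu α (k + 1) (r - 1) j +
      lam (j - (r - 1 - k)) * blockDet n lam mu α (k + 1) r j *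
        blockDet n lam mu α (k + 1) (r - 1) (j + 1) := by
  have hcast : ∀ c : ℕ, j + ((c + 1 : ℕ) : ℤ) = j + 1 + c := fun c => by push_cast; ring
  have h := desnanot_jacobi k
    (Matrix.of fun m m' : Fin (k + 2) => condensedRow n lam mu α r j m m')
  rw [← blockDet_succ hα0] at h
  have h1 : ((Matrix.of fun m m' : Fin (k + 2) => condensedRow n lam mu α r j m m').submatrix
      (fun i : Fin k => i.castSucc.succ) fun i => i.castSucc.succ).det =
      (∏ m : Fin k, lam (j - (r - 1 - (m : ℕ)))) * blockDet n lam mu α k (r - 1) (j + 1) := by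
    rw [← det_entryGreen_shift hlam]
    congr 1; ext m m'
    simp [condensedRow, add_comm, add_left_comm]
  have h2 : ((Matrix.of fun m m' : Fin (k + 2) => condensedRow n lam mu α r j m m').submatrix
      Fin.succ Fin.succ).det = (∏ m : Fin (k + 1), lam (j - (r - 1 - (m : ℕ)))) *
        blockDet n lam mu α (k + 1) (r - 1) (j + 1) := by
    rw [← det_entryGreen_shift hlam]
    congr 1; ext m m'
    simp [condensedRow, add_comm, add_left_comm]
  have h3 : ((Matrix.of fun m m' : Fin (k + 2) => condensedRow n lam mu α r j m m').submatrix
      Fin.castSucc Fin.castSucc).det = blockDet n lam mu α (k + 1) r j := by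
    rw [blockDet_succ hα0]
    congr 1
  have h4 : ((Matrix.of fun m m' : Fin (k + 2) => condensedRow n lam mu α r j m m').submatrix
      Fin.succ Fin.castSucc).det = blockDet n lam mu α (k + 1) (r - 1) j := by
    rw [blockDet]
    congr 1
  have h5 : ((Matrix.of fun m m' : Fin (k + 2) => condensedRow n lam mu α r j m m').submatrix
      Fin.castSucc Fin.succ).det = -mu (r + j + 1 - n) *
        (∏ m : Fin k, lam (j - (r - 1 - (m : ℕ)))) * blockDet n lam mu α (k + 1) r (j + 1) := by
    rw [← det_condensedRow_shift hα0 hlam]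
    congr 1
  rw [h1, h2, h3, h4, h5, Fin.prod_univ_castSucc] at h
  simp only [Fin.val_castSucc, Fin.val_last] at h
  have hne : (∏ m : Fin k, lam (j - (r - 1 - ((m : ℕ) : ℤ)))) ≠ 0 :=
    Finset.prod_ne_zero_iff.mpr fun _ _ => hlam _
  apply mul_left_cancel₀ hne
  linear_combination h

end Octahedron

/-! ### Path partition functions as matrix elements of the resolvent -/

section Paths

variable {K : Type*} [Field K]

theorem mem_networkVertices {n : ℕ} {v : ℤ × ℤ} :
    v ∈ networkVertices n ↔ (v.1 + v.2) % 2 = 0 ∧ 0 ≤ v.1 + v.2 ∧ v.1 + v.2 ≤ 2 * (n - 1) ∧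
      v.1 ≤ v.2 ∧ v.2 - v.1 ≤ 2 * (n - 1) := by
  simp only [networkVertices, Set.mem_ofPred_eq, Int.even_iff]
  rcases abs_cases v.1 with h | h <;> rcases abs_cases (v.2 - n + 1) with h' | h' <;> omega

theorem IsNetPath.mem {n : ℕ} {u e : ℤ × ℤ} {p : List NetStep} (h : IsNetPath n u e p) :
    u ∈ networkVertices n := by
  cases p <;> exact h.1

theorem IsNetPath.fst_le {n : ℕ} {u e : ℤ × ℤ} {p : List NetStep} (h : IsNetPath n u e p) :
    u.1 ≤ e.1 := by
  induction p generalizing u with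
  | nil => rw [h.2]
  | cons s p ih =>
    have := ih h.2
    cases s <;> simp [NetStep.disp] at this <;> omega

theorem green_eq_zero_of_notMem {n : ℕ} (lam mu : ℤ → K) (α : ℤ × ℤ → K) {u e : ℤ × ℤ}
    (hu : u ∈ networkVertices n) (he : e ∈ networkVertices n) (s : NetStep)
    (hs : u + s.disp ∉ networkVertices n) : green n lam mu α (u + s.disp) e = 0 := by
  apply green_eq_zero
  rw [mem_networkVertices] at hu he hs
  rw [lt_abs]
  cases s <;> simp only [NetStep.disp, Prod.fst_add, Prod.snd_add] at hs ⊢ <;> omega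

theorem setOf_isNetPath_eq {n : ℕ} {u e : ℤ × ℤ} (hu : u ∈ networkVertices n) :
    {p | IsNetPath n u e p} = {p | p = [] ∧ u = e} ∪
      (List.cons NetStep.up '' {p | IsNetPath n (u + NetStep.up.disp) e p} ∪
      List.cons NetStep.flat '' {p | IsNetPath n (u + NetStep.flat.disp) e p} ∪
      List.cons NetStep.down '' {p | IsNetPath n (u + NetStep.down.disp) e p}) := by
  ext p
  rcases p with _ | ⟨_ | _ | _, p⟩ <;> simp [IsNetPath, hu]

theorem finsum_netPathWeight_cons (n : ℕ) (lam mu : ℤ → K) (α : ℤ × ℤ → K) (u e : ℤ × ℤ)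
    (s : NetStep) :
    ∑ᶠ p ∈ List.cons s '' {p | IsNetPath n (u + s.disp) e p}, netPathWeight n lam mu α u p =
      s.weight n lam mu α u * netPartition n lam mu α (u + s.disp) e := by
  rw [finsum_mem_image (List.cons_injective.injOn), netPartition, mul_finsum_mem]
  rfl

theorem netPartition_eq_green (n : ℕ) (lam mu : ℤ → K) (α : ℤ × ℤ → K) {e : ℤ × ℤ}
    (he : e ∈ networkVertices n) (u : ℤ × ℤ) :
    {p | IsNetPath n u e p}.Finite ∧
    (u ∈ networkVertices n → netPartition n lam mu α u e = green n lam mu α u e) := by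
  have key : ∀ (m : ℕ) (u : ℤ × ℤ), e.1 - u.1 < m → {p | IsNetPath n u e p}.Finite ∧
      (u ∈ networkVertices n → netPartition n lam mu α u e = green n lam mu α u e) := by
    intro m
    induction m with
    | zero =>
      intro u hu
      have h0 : {p | IsNetPath n u e p} = ∅ := by
        ext p
        simp only [Set.mem_ofPred_eq, Set.mem_empty_iff_false, iff_false]
        intro h
        have := h.fst_le
        push_cast at hu
        omega
      refine ⟨by simp [h0], fun _ => ?_⟩
      rw [netPartition, h0, finsum_mem_empty, green_eq_zero]
      have := abs_nonneg (e.2 - u.2)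
      push_cast at hu
      omega
    | succ m ih =>
      intro u hu
      by_cases hmem : u ∈ networkVertices n
      swap
      · have h0 : {p | IsNetPath n u e p} = ∅ := by
          ext p
          simp only [Set.mem_ofPred_eq, Set.mem_empty_iff_false, iff_false]
          exact fun h => hmem h.mem
        exact ⟨by simp [h0], fun h => absurd h hmem⟩
      have hfin : ∀ s : NetStep, {p | IsNetPath n (u + s.disp) e p}.Finite := fun s =>
        (ih (u + s.disp) (by cases s <;> simp [NetStep.disp] <;> omega)).1
      have hval : ∀ s : NetStep, netPartition n lam mu α (u + s.disp) e =
          green n lam mu α (u + s.disp) e := by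
        intro s
        by_cases hs : u + s.disp ∈ networkVertices n
        · exact (ih (u + s.disp) (by cases s <;> simp [NetStep.disp] <;> omega)).2 hs
        · rw [green_eq_zero_of_notMem lam mu α hmem he s hs, netPartition]
          exact finsum_mem_eq_zero_of_forall_eq_zero fun p hp => absurd (IsNetPath.mem hp) hs
      have hnil : {p : List NetStep | p = [] ∧ u = e}.Finite :=
        (Set.finite_singleton []).subset fun p hp => hp.1
      have hf := fun s => (hfin s).image (List.cons s)
      rw [setOf_isNetPath_eq hmem]
      refine ⟨hnil.union (((hf _).union (hf _)).union (hf _)), fun _ => ?_⟩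
      rw [netPartition, setOf_isNetPath_eq hmem, finsum_mem_union _ hnil
        (((hf _).union (hf _)).union (hf _)), finsum_mem_union _ ((hf _).union (hf _)) (hf _),
        finsum_mem_union _ (hf _) (hf _), finsum_netPathWeight_cons,
        finsum_netPathWeight_cons,
        finsum_netPathWeight_cons, hval, hval, hval,
        green_eq_first_step n lam mu α u e]
      · congr 1
        split_ifs with h
        · rw [show {p : List NetStep | p = [] ∧ u = e} = {[]} by ext; simp [h],
            finsum_mem_singleton]
          rfl
        · simp [h]
      all_goals
        rw [Set.disjoint_left]
        rintro p hp hp'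
        simp only [Set.mem_union, Set.mem_image, Set.mem_ofPred_eq] at hp hp'
        aesop
  exact key (e.1 - u.1 + 1).toNat u (by omega)

end Paths

/-! ### Values of rational functions at a point -/

section Values

variable {σ K : Type*} [Field K] {p : σ → K}

theorem hasValueAt_algebraMap (P : MvPolynomial σ ℤ) :
    HasValueAt (algebraMap _ (FractionRing (MvPolynomial σ ℤ)) P) p (MvPolynomial.aeval p P) :=
  ⟨P, 1, by simp, by simp, by simp⟩

theorem HasValueAt.add {f g : FractionRing (MvPolynomial σ ℤ)} {d e : K}
    (hf : HasValueAt f p d) (hg : HasValueAt g p e) : HasValueAt (f + g) p (d + e) := by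
  obtain ⟨N, D, h1, h2, h3⟩ := hf
  obtain ⟨N', D', h1', h2', h3'⟩ := hg
  refine ⟨N * D' + N' * D, D * D', by simp [h1, h1'], ?_, ?_⟩
  · simp only [map_mul, map_add, ← h2, ← h2']; ring
  · simp only [map_mul, map_add, ← h3, ← h3']; ring

theorem HasValueAt.mul {f g : FractionRing (MvPolynomial σ ℤ)} {d e : K}
    (hf : HasValueAt f p d) (hg : HasValueAt g p e) : HasValueAt (f * g) p (d * e) := by
  obtain ⟨N, D, h1, h2, h3⟩ := hf
  obtain ⟨N', D', h1', h2', h3'⟩ := hg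
  refine ⟨N * N', D * D', by simp [h1, h1'], ?_, ?_⟩
  · simp only [map_mul, ← h2, ← h2']; ring
  · simp only [map_mul, ← h3, ← h3']; ring

theorem HasValueAt.neg {f : FractionRing (MvPolynomial σ ℤ)} {d : K}
    (hf : HasValueAt f p d) : HasValueAt (-f) p (-d) := by
  obtain ⟨N, D, h1, h2, h3⟩ := hf
  exact ⟨-N, D, h1, by simp [h2], by simp [h3]⟩

theorem hasValueAt_zero : HasValueAt (0 : FractionRing (MvPolynomial σ ℤ)) p 0 := by
  simpa using hasValueAt_algebraMap (p := p) 0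

theorem hasValueAt_one : HasValueAt (1 : FractionRing (MvPolynomial σ ℤ)) p 1 := by
  simpa using hasValueAt_algebraMap (p := p) 1

theorem HasValueAt.div {f g : FractionRing (MvPolynomial σ ℤ)} {d e : K}
    (hf : HasValueAt f p d) (hg : HasValueAt g p e) (he : e ≠ 0) :
    HasValueAt (f / g) p (d / e) := by
  obtain ⟨N, D, h1, h2, h3⟩ := hf
  obtain ⟨N', D', h1', h2', h3'⟩ := hg
  have hN' : MvPolynomial.aeval p N' ≠ 0 := by rw [← h3']; exact mul_ne_zero he h1'
  have hg0 : g ≠ 0 := by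
    rintro rfl
    rw [zero_mul, eq_comm, FaithfulSMul.algebraMap_eq_zero_iff] at h2'
    simp [h2'] at hN'
  refine ⟨N * D', D * N', by simp [h1, hN'], ?_, ?_⟩
  · simp only [map_mul, ← h2, ← h2']; field_simp
  · simp only [map_mul, ← h3, ← h3']; field_simp

theorem HasValueAt.unique {f : FractionRing (MvPolynomial σ ℤ)} {d e : K}
    (hf : HasValueAt f p d) (hg : HasValueAt f p e) : d = e := by
  obtain ⟨N, D, h1, h2, h3⟩ := hf
  obtain ⟨N', D', h1', h2', h3'⟩ := hg
  have h : N * D' = N' * D := by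
    apply FaithfulSMul.algebraMap_injective (MvPolynomial σ ℤ) (FractionRing (MvPolynomial σ ℤ))
    simp only [map_mul, ← h2, ← h2']; ring
  have h' := congrArg (MvPolynomial.aeval p) h
  simp only [map_mul, ← h3, ← h3'] at h'
  apply mul_right_cancel₀ (mul_ne_zero h1 h1')
  linear_combination h'

/-- The pairs of a rational function regular at `p` and its value. -/
def valueSubring (p : σ → K) : Subring (FractionRing (MvPolynomial σ ℤ) × K) where
  carrier := {x | HasValueAt x.1 p x.2}
  mul_mem' h h' := HasValueAt.mul h h'
  one_mem' := hasValueAt_one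
  add_mem' h h' := HasValueAt.add h h'
  zero_mem' := hasValueAt_zero
  neg_mem' h := HasValueAt.neg h

theorem HasValueAt.det {k : ℕ} {M : Matrix (Fin k) (Fin k) (FractionRing (MvPolynomial σ ℤ))}
    {M' : Matrix (Fin k) (Fin k) K} (h : ∀ i j, HasValueAt (M i j) p (M' i j)) :
    HasValueAt M.det p M'.det := by
  let Q : Matrix (Fin k) (Fin k) (valueSubring p) := fun i j => ⟨(M i j, M' i j), h i j⟩
  have hQ : HasValueAt (Q.det : FractionRing (MvPolynomial σ ℤ) × K).1 p Q.det.1.2 := Q.det.2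
  have h1 : Q.det.1.1 = M.det :=
    RingHom.map_det ((RingHom.fst _ K).comp (valueSubring p).subtype) Q
  have h2 : Q.det.1.2 = M'.det :=
    RingHom.map_det ((RingHom.snd (FractionRing (MvPolynomial σ ℤ)) K).comp
      (valueSubring p).subtype) Q
  rwa [h1, h2] at hQ

end Values

/-! ### Blocks of a matrix and their condensation -/

section BlockMatrix

variable {R : Type*}

theorem comp_add_congr {f : ℤ → R} {b c d : ℤ} (h : b + c = d) :
    (fun a => f (a + b + c)) = fun a => f (a + d) := by
  funext a; rw [add_assoc, h]

theorem comp_sub_congr {f : ℤ → R} {b c d : ℤ} (h : c - b = d) :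
    (fun a => f (a - b + c)) = fun a => f (a + d) := by
  funext a; rw [← h]; ring_nf

variable (n : ℕ) (α : ℤ × ℤ → R)

/-- The block with top row `i` and left column `j`. -/
def blockMatrix (k : ℕ) (i j : ℤ) : Matrix (Fin k) (Fin k) R :=
  Matrix.of fun m m' => α (latticePos n (i + (m : ℕ)) (j + (m' : ℕ)))

theorem blockMatrix_submatrix_succ_succ (k : ℕ) (i j : ℤ) :
    (blockMatrix n α (k + 1) i j).submatrix Fin.succ Fin.succ =
      blockMatrix n α k (i + 1) (j + 1) := by
  ext m m'; simp [blockMatrix, add_comm, add_left_comm]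

theorem blockMatrix_submatrix_castSucc_castSucc (k : ℕ) (i j : ℤ) :
    (blockMatrix n α (k + 1) i j).submatrix Fin.castSucc Fin.castSucc =
      blockMatrix n α k i j := by
  ext m m'; simp [blockMatrix]

theorem blockMatrix_submatrix_succ_castSucc (k : ℕ) (i j : ℤ) :
    (blockMatrix n α (k + 1) i j).submatrix Fin.succ Fin.castSucc =
      blockMatrix n α k (i + 1) j := by
  ext m m'; simp [blockMatrix, add_comm, add_left_comm]

theorem blockMatrix_submatrix_castSucc_succ (k : ℕ) (i j : ℤ) :
    (blockMatrix n α (k + 1) i j).submatrix Fin.castSucc Fin.succ =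
      blockMatrix n α k i (j + 1) := by
  ext m m'; simp [blockMatrix, add_comm, add_left_comm]

theorem blockMatrix_submatrix_inner (k : ℕ) (i j : ℤ) :
    (blockMatrix n α (k + 2) i j).submatrix (fun m : Fin k => m.castSucc.succ)
      (fun m : Fin k => m.castSucc.succ) = blockMatrix n α k (i + 1) (j + 1) := by
  ext m m'; simp [blockMatrix, add_comm, add_left_comm]

theorem blockMatrix_zero_zero {n : ℕ} {A : Matrix (Fin n) (Fin n) R} {α : ℤ × ℤ → R}
    (hα : ∀ i j : Fin n, α (latticePos n i j) = A i j) :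
    blockMatrix n α n 0 0 = A := by
  ext i j; simp [blockMatrix, hα]

end BlockMatrix

section Blocks

variable {K : Type*} [Field K]

/-- The function on the lattice that carries the entries of `A` at the points of the network and
is `1` elsewhere. -/
def extendEntries {n : ℕ} (A : Matrix (Fin n) (Fin n) K) (v : ℤ × ℤ) : K :=
  if h : (0 ≤ (v.1 - v.2) / 2 + n - 1 ∧ (v.1 - v.2) / 2 + n - 1 < n) ∧
      (0 ≤ (v.1 + v.2) / 2 ∧ (v.1 + v.2) / 2 < n) then
    A ⟨((v.1 - v.2) / 2 + n - 1).toNat, by omega⟩ ⟨((v.1 + v.2) / 2).toNat, by omega⟩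
  else 1

theorem extendEntries_latticePos {n : ℕ} (A : Matrix (Fin n) (Fin n) K) (i j : Fin n) :
    extendEntries A (latticePos n i j) = A i j := by
  have h1 : ((latticePos n i j).1 - (latticePos n i j).2) / 2 + n - 1 = i := by
    simp only [latticePos]; omega
  have h2 : ((latticePos n i j).1 + (latticePos n i j).2) / 2 = j := by
    simp only [latticePos]; omega
  simp only [extendEntries, h1, h2, Int.toNat_natCast, Fin.eta]
  exact dif_pos ⟨⟨by omega, by omega⟩, by omega, by omega⟩

theorem extendEntries_ne_zero {n : ℕ} {A : Matrix (Fin n) (Fin n) K} (hA : ∀ i j, A i j ≠ 0)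
    (v : ℤ × ℤ) : extendEntries A v ≠ 0 := by
  unfold extendEntries
  split_ifs
  · exact hA _ _
  · exact one_ne_zero

variable (n : ℕ) (lam mu : ℤ → K) (α : ℤ × ℤ → K)

/-- The Lambda-determinant of a block, with the parameters that it has in the condensation of the
whole matrix. -/
def blockLambdaDet (k : ℕ) (i j : ℤ) : K :=
  lambdaDet k (fun a => lam (a + (j - i))) (fun a => mu (a + (i + j + k - n)))
    (blockMatrix n α k i j)

/-- The condensation of a block never divides by zero. -/
def BlockDefined (k : ℕ) (i j : ℤ) : Prop :=
  CondensationDefined k (fun a => lam (a + (j - i))) (fun a => mu (a + (i + j + k - n)))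
    (blockMatrix n α k i j)

theorem blockLambdaDet_succ_succ (k : ℕ) (i j : ℤ) :
    blockLambdaDet n lam mu α (k + 2) i j =
      (mu (i + j + k + 2 - n) * blockLambdaDet n lam mu α (k + 1) (i + 1) (j + 1) *
          blockLambdaDet n lam mu α (k + 1) i j +
        lam (j - i) * blockLambdaDet n lam mu α (k + 1) (i + 1) j *
          blockLambdaDet n lam mu α (k + 1) i (j + 1)) /
        blockLambdaDet n lam mu α k (i + 1) (j + 1) := by
  conv_lhs => rw [blockLambdaDet, lambdaDet]
  simp only [blockMatrix_submatrix_succ_succ, blockMatrix_submatrix_castSucc_castSucc,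
    blockMatrix_submatrix_succ_castSucc, blockMatrix_submatrix_castSucc_succ,
    blockMatrix_submatrix_inner, zero_add]
  rw [comp_add_congr (f := mu) (d := i + 1 + (j + 1) + (k + 1 : ℕ) - n) (by push_cast; ring),
    comp_sub_congr (f := mu) (d := i + j + (k + 1 : ℕ) - n) (by push_cast; ring),
    comp_sub_congr (f := lam) (d := j - (i + 1)) (by ring),
    comp_add_congr (f := lam) (d := j + 1 - i) (by ring)]
  simp only [blockLambdaDet]
  rw [show i + j + ((k + 2 : ℕ) : ℤ) - n = i + j + k + 2 - n by push_cast; ring,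
    show i + 1 + j + ((k + 1 : ℕ) : ℤ) - n = i + j + k + 2 - n by push_cast; ring,
    show i + (j + 1) + ((k + 1 : ℕ) : ℤ) - n = i + j + k + 2 - n by push_cast; ring,
    show i + 1 + (j + 1) + (k : ℤ) - n = i + j + k + 2 - n by ring,
    show j + 1 - (i + 1) = j - i by ring]

theorem blockDefined_succ_succ (k : ℕ) (i j : ℤ) :
    BlockDefined n lam mu α (k + 2) i j ↔
      BlockDefined n lam mu α (k + 1) (i + 1) (j + 1) ∧ BlockDefined n lam mu α (k + 1) i j ∧
      BlockDefined n lam mu α (k + 1) (i + 1) j ∧ BlockDefined n lam mu α (k + 1) i (j + 1) ∧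
      BlockDefined n lam mu α k (i + 1) (j + 1) ∧
      blockLambdaDet n lam mu α k (i + 1) (j + 1) ≠ 0 := by
  conv_lhs => rw [BlockDefined, CondensationDefined]
  simp only [blockMatrix_submatrix_succ_succ, blockMatrix_submatrix_castSucc_castSucc,
    blockMatrix_submatrix_succ_castSucc, blockMatrix_submatrix_castSucc_succ,
    blockMatrix_submatrix_inner]
  rw [comp_add_congr (f := mu) (d := i + 1 + (j + 1) + (k + 1 : ℕ) - n) (by push_cast; ring),
    comp_sub_congr (f := mu) (d := i + j + (k + 1 : ℕ) - n) (by push_cast; ring),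
    comp_sub_congr (f := lam) (d := j - (i + 1)) (by ring),
    comp_add_congr (f := lam) (d := j + 1 - i) (by ring)]
  simp only [BlockDefined, blockLambdaDet]
  rw [show i + j + ((k + 2 : ℕ) : ℤ) - n = i + j + k + 2 - n by push_cast; ring,
    show i + 1 + j + ((k + 1 : ℕ) : ℤ) - n = i + j + k + 2 - n by push_cast; ring,
    show i + (j + 1) + ((k + 1 : ℕ) : ℤ) - n = i + j + k + 2 - n by push_cast; ring,
    show i + 1 + (j + 1) + (k : ℤ) - n = i + j + k + 2 - n by ring,
    show j + 1 - (i + 1) = j - i by ring]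

/-- The octahedron relation for the determinants of the resolvent, on the blocks of the matrix. -/
def SatisfiesOctahedron : Prop :=
  ∀ (k : ℕ) (i j : ℤ), 0 ≤ i → 0 ≤ j → i + k + 2 ≤ n → j + k + 2 ≤ n →
    blockDet n lam mu α (k + 2) (i + k + 1) j * blockDet n lam mu α k (i + k) (j + 1) =
      mu (i + j + k + 2 - n) * blockDet n lam mu α (k + 1) (i + k + 1) (j + 1) *
        blockDet n lam mu α (k + 1) (i + k) j +
      lam (j - i) * blockDet n lam mu α (k + 1) (i + k + 1) j *
        blockDet n lam mu α (k + 1) (i + k) (j + 1)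

variable {n lam mu α}

theorem satisfiesOctahedron_of_ne_zero (hα0 : ∀ v, α v ≠ 0) (hlam : ∀ a, lam a ≠ 0) :
    SatisfiesOctahedron n lam mu α := by
  intro k i j _ _ _ _
  have h := blockDet_octahedron (n := n) (mu := mu) hα0 hlam k (i + k + 1) j
  rw [show i + (k : ℤ) + 1 - 1 = i + k by ring, show j - (i + (k : ℤ) - k) = j - i by ring,
    show i + (k : ℤ) + 1 + j + 1 - n = i + j + k + 2 - n by ring] at h
  exact h

theorem blockLambdaDet_eq_blockDet (hoct : SatisfiesOctahedron n lam mu α) (k : ℕ) :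
    ∀ i j : ℤ, 0 ≤ i → 0 ≤ j → i + k ≤ n → j + k ≤ n → BlockDefined n lam mu α k i j →
      blockLambdaDet n lam mu α k i j = blockDet n lam mu α k (i + k - 1) j := by
  induction k using Nat.strong_induction_on with
  | _ k ih =>
    intro i j hi hj hik hjk hdef
    match k with
    | 0 => simp [blockLambdaDet, lambdaDet, blockDet]
    | 1 => simp [blockLambdaDet, lambdaDet, blockDet, blockMatrix, entryGreen_self]
    | k + 2 =>
      push_cast at hik hjk
      rw [blockDefined_succ_succ] at hdef
      obtain ⟨h1, h2, h3, h4, h5, h6⟩ := hdef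
      have e1 := ih (k + 1) (by omega) (i + 1) (j + 1) (by omega) (by omega)
        (by push_cast; omega) (by push_cast; omega) h1
      have e2 := ih (k + 1) (by omega) i j (by omega) (by omega)
        (by push_cast; omega) (by push_cast; omega) h2
      have e3 := ih (k + 1) (by omega) (i + 1) j (by omega) (by omega)
        (by push_cast; omega) (by push_cast; omega) h3
      have e4 := ih (k + 1) (by omega) i (j + 1) (by omega) (by omega)
        (by push_cast; omega) (by push_cast; omega) h4
      have e5 := ih k (by omega) (i + 1) (j + 1) (by omega) (by omega)
        (by omega) (by omega) h5
      rw [blockLambdaDet_succ_succ, div_eq_iff h6, e1, e2, e3, e4, e5]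
      rw [show i + ((k + 2 : ℕ) : ℤ) - 1 = i + k + 1 by push_cast; ring,
        show i + 1 + ((k + 1 : ℕ) : ℤ) - 1 = i + k + 1 by push_cast; ring,
        show i + ((k + 1 : ℕ) : ℤ) - 1 = i + k by push_cast; ring,
        show i + 1 + (k : ℤ) - 1 = i + k by ring]
      exact (hoct k i j hi hj (by omega) (by omega)).symm

theorem blockDefined_of_blockDet_ne_zero (hoct : SatisfiesOctahedron n lam mu α)
    (hne : ∀ (k : ℕ) (i j : ℤ), 0 ≤ i → 0 ≤ j → i + k ≤ n → j + k ≤ n →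
      blockDet n lam mu α k (i + k - 1) j ≠ 0) (k : ℕ) :
    ∀ i j : ℤ, 0 ≤ i → 0 ≤ j → i + k ≤ n → j + k ≤ n → BlockDefined n lam mu α k i j := by
  induction k using Nat.strong_induction_on with
  | _ k ih =>
    intro i j hi hj hik hjk
    match k with
    | 0 => trivial
    | 1 => trivial
    | k + 2 =>
      push_cast at hik hjk
      have h5 := ih k (by omega) (i + 1) (j + 1) (by omega) (by omega) (by omega) (by omega)
      rw [blockDefined_succ_succ]
      refine ⟨ih _ (by omega) _ _ ?_ ?_ ?_ ?_, ih _ (by omega) _ _ ?_ ?_ ?_ ?_,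
        ih _ (by omega) _ _ ?_ ?_ ?_ ?_, ih _ (by omega) _ _ ?_ ?_ ?_ ?_, h5, ?_⟩
      all_goals first | (push_cast; omega) | skip
      rw [blockLambdaDet_eq_blockDet hoct k _ _ (by omega) (by omega) (by omega) (by omega) h5]
      exact hne k _ _ (by omega) (by omega) (by omega) (by omega)

theorem blockDet_pos (n : ℕ) (k : ℕ) : ∀ r j : ℤ,
    0 < blockDet n (fun _ => (1 : ℚ)) (fun _ => 1) (fun _ => 1) k r j := by
  induction k using Nat.strong_induction_on with
  | _ k ih =>
    intro r j
    match k with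
    | 0 => simp [blockDet]
    | 1 => simp [blockDet, entryGreen_self]
    | k + 2 =>
      have h := blockDet_octahedron (n := n) (lam := fun _ => (1 : ℚ)) (mu := fun _ => 1)
        (α := fun _ => 1) (fun _ => one_ne_zero) (fun _ => one_ne_zero) k r j
      have h0 := ih k (by omega) (r - 1) (j + 1)
      have h1 := ih (k + 1) (by omega)
      refine pos_of_mul_pos_left ?_ h0.le
      rw [h]
      have := mul_pos (h1 r (j + 1)) (h1 (r - 1) j)
      have := mul_pos (h1 r j) (h1 (r - 1) (j + 1))
      linarith

end Blocks

/-! ### Specialization of the generic matrix -/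

section Specialization

/-- The sequence of indeterminates `λ_a`. -/
noncomputable def genericLam (n : ℕ) (a : ℤ) : LambdaField n :=
  algebraMap (MvPolynomial (LambdaVar n) ℤ) (LambdaField n) (MvPolynomial.X (Sum.inr (Sum.inl a)))

/-- The sequence of indeterminates `μ_a`. -/
noncomputable def genericMu (n : ℕ) (a : ℤ) : LambdaField n :=
  algebraMap (MvPolynomial (LambdaVar n) ℤ) (LambdaField n) (MvPolynomial.X (Sum.inr (Sum.inr a)))

/-- The matrix of indeterminates. -/
noncomputable def genericMatrix (n : ℕ) : Matrix (Fin n) (Fin n) (LambdaField n) :=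
  Matrix.of fun i j => algebraMap (MvPolynomial (LambdaVar n) ℤ) (LambdaField n)
    (MvPolynomial.X (Sum.inl (i, j)))

theorem algebraMap_X_ne_zero (n : ℕ) (x : LambdaVar n) :
    algebraMap (MvPolynomial (LambdaVar n) ℤ) (LambdaField n) (MvPolynomial.X x) ≠ 0 := by
  rw [Ne, FaithfulSMul.algebraMap_eq_zero_iff]
  exact MvPolynomial.X_ne_zero x

theorem genericEntries_ne_zero (n : ℕ) (v : ℤ × ℤ) : extendEntries (genericMatrix n) v ≠ 0 :=
  extendEntries_ne_zero (fun i j => algebraMap_X_ne_zero n (Sum.inl (i, j))) v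

variable {K : Type*} [Field K] {n : ℕ} {lam mu : ℤ → K} {A : Matrix (Fin n) (Fin n) K}
  {α : ℤ × ℤ → K}

theorem hasValueAt_X {σ : Type*} {p : σ → K} (x : σ) :
    HasValueAt (algebraMap (MvPolynomial σ ℤ) (FractionRing (MvPolynomial σ ℤ))
      (MvPolynomial.X x)) p (p x) := by
  simpa using hasValueAt_algebraMap (p := p) (MvPolynomial.X x)

theorem hasValueAt_genericLam (a : ℤ) :
    HasValueAt (genericLam n a) (lambdaPoint n lam mu A) (lam a) :=
  hasValueAt_X _

theorem hasValueAt_genericMu (a : ℤ) :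
    HasValueAt (genericMu n a) (lambdaPoint n lam mu A) (mu a) :=
  hasValueAt_X _

theorem hasValueAt_genericEntries (hα : ∀ i j : Fin n, α (latticePos n i j) = A i j) {r c : ℤ}
    (hr : 0 ≤ r) (hr' : r < n) (hc : 0 ≤ c) (hc' : c < n) :
    HasValueAt (extendEntries (genericMatrix n) (latticePos n r c)) (lambdaPoint n lam mu A)
      (α (latticePos n r c)) := by
  lift r to ℕ using hr
  lift c to ℕ using hc
  have h1 := hα ⟨r, by omega⟩ ⟨c, by omega⟩
  have h2 := extendEntries_latticePos (genericMatrix n) ⟨r, by omega⟩ ⟨c, by omega⟩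
  dsimp only at h1 h2
  rw [h1, h2]
  exact hasValueAt_X (p := lambdaPoint n lam mu A) (Sum.inl (⟨r, by omega⟩, ⟨c, by omega⟩))

theorem hasValueAt_green (hα0 : ∀ v, α v ≠ 0)
    (hα : ∀ i j : Fin n, α (latticePos n i j) = A i j) {r c : ℤ} (hr : r < n) (hc : c < n)
    {s j : ℤ} (hs : 0 ≤ s) (hj : 0 ≤ j) :
    HasValueAt (green n (genericLam n) (genericMu n) (extendEntries (genericMatrix n))
      (latticePos n s j) (latticePos n r c)) (lambdaPoint n lam mu A)
      (green n lam mu α (latticePos n s j) (latticePos n r c)) := by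
  have key : ∀ (m : ℕ) (s j : ℤ), 0 ≤ s → 0 ≤ j → r - s + (c - j) < m →
      HasValueAt (green n (genericLam n) (genericMu n) (extendEntries (genericMatrix n))
        (latticePos n s j) (latticePos n r c)) (lambdaPoint n lam mu A)
        (green n lam mu α (latticePos n s j) (latticePos n r c)) := by
    intro m
    induction m with
    | zero =>
      intro s j _ _ h
      push_cast at h
      rw [green_latticePos_eq_zero _ _ _ _ (by omega), green_latticePos_eq_zero _ _ _ _ (by omega)]
      exact hasValueAt_zero
    | succ m ih =>
      intro s j hs hj h
      push_cast at h
      by_cases hz : r < s ∨ c < j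
      · rw [green_latticePos_eq_zero _ _ _ _ hz, green_latticePos_eq_zero _ _ _ _ hz]
        exact hasValueAt_zero
      rw [green_latticePos_first_step n (genericLam n), green_latticePos_first_step n lam]
      have hdiv : s + 1 ≤ r → HasValueAt (extendEntries (genericMatrix n) (latticePos n s j) /
          extendEntries (genericMatrix n) (latticePos n (s + 1) j)) (lambdaPoint n lam mu A)
          (α (latticePos n s j) / α (latticePos n (s + 1) j)) := fun h' =>
        (hasValueAt_genericEntries hα (by omega) (by omega) (by omega) (by omega)).div
          (hasValueAt_genericEntries hα (by omega) (by omega) (by omega) (by omega)) (hα0 _)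
      refine HasValueAt.add ?_ (HasValueAt.add (HasValueAt.add ?_ ?_) ?_)
      · split_ifs
        · exact hasValueAt_one
        · exact hasValueAt_zero
      · exact (hasValueAt_genericLam _).mul (ih s (j + 1) (by omega) (by omega) (by omega))
      · by_cases h' : s + 1 ≤ r
        · exact ((hasValueAt_genericMu _).mul (hdiv h')).mul
            (ih (s + 1) (j + 1) (by omega) (by omega) (by omega))
        · rw [green_latticePos_eq_zero _ _ _ _ (by omega),
            green_latticePos_eq_zero _ _ _ _ (by omega), mul_zero, mul_zero]
          exact hasValueAt_zero
      · by_cases h' : s + 1 ≤ r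
        · exact (hdiv h').mul (ih (s + 1) j (by omega) (by omega) (by omega))
        · rw [green_latticePos_eq_zero _ _ _ _ (by omega),
            green_latticePos_eq_zero _ _ _ _ (by omega), mul_zero, mul_zero]
          exact hasValueAt_zero
  exact key (r - s + (c - j) + 1).toNat s j hs hj (by omega)

theorem hasValueAt_blockDet (hα0 : ∀ v, α v ≠ 0)
    (hα : ∀ i j : Fin n, α (latticePos n i j) = A i j) (k : ℕ) {r j : ℤ} (hr : k ≤ r + 1)
    (hr' : r < n) (hj : 0 ≤ j) (hj' : j + k ≤ n) :
    HasValueAt (blockDet n (genericLam n) (genericMu n) (extendEntries (genericMatrix n)) k r j)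
      (lambdaPoint n lam mu A) (blockDet n lam mu α k r j) := by
  refine HasValueAt.det fun m m' => ?_
  have := m.2
  have := m'.2
  exact (hasValueAt_genericEntries hα (by omega) (by omega) (by omega) (by omega)).mul
    (hasValueAt_green hα0 hα (by omega) (by omega) (by omega) (by omega))

theorem satisfiesOctahedron_generic (n : ℕ) :
    SatisfiesOctahedron n (genericLam n) (genericMu n) (extendEntries (genericMatrix n)) :=
  satisfiesOctahedron_of_ne_zero (genericEntries_ne_zero n)
    fun a => algebraMap_X_ne_zero n (Sum.inr (Sum.inl a))

theorem satisfiesOctahedron (lam mu : ℤ → K) (hα0 : ∀ v, α v ≠ 0)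
    (hα : ∀ i j : Fin n, α (latticePos n i j) = A i j) : SatisfiesOctahedron n lam mu α := by
  intro k i j hi hj hik hjk
  have hB := fun (k : ℕ) {r j : ℤ} => hasValueAt_blockDet (lam := lam) (mu := mu) hα0 hα k (r := r)
    (j := j)
  have h1 : HasValueAt _ _ _ :=
    (hB (k + 2) (r := i + k + 1) (j := j) (by push_cast; omega) (by omega) (by omega)
      (by push_cast; omega)).mul
      (hB k (r := i + k) (j := j + 1) (by omega) (by omega) (by omega) (by omega))
  have h2 : HasValueAt _ _ _ :=
    (((hasValueAt_genericMu (lam := lam) (A := A) (i + j + k + 2 - n)).mul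
      (hB (k + 1) (r := i + k + 1) (j := j + 1) (by push_cast; omega) (by omega) (by omega)
        (by push_cast; omega))).mul
      (hB (k + 1) (r := i + k) (j := j) (by push_cast; omega) (by omega) (by omega)
        (by push_cast; omega))).add
    (((hasValueAt_genericLam (mu := mu) (A := A) (j - i)).mul
      (hB (k + 1) (r := i + k + 1) (j := j) (by push_cast; omega) (by omega) (by omega)
        (by push_cast; omega))).mul
      (hB (k + 1) (r := i + k) (j := j + 1) (by push_cast; omega) (by omega) (by omega)
        (by push_cast; omega)))
  rw [← satisfiesOctahedron_generic n k i j hi hj hik hjk] at h2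
  exact h1.unique h2

theorem blockDet_generic_ne_zero (n k : ℕ) (i j : ℤ) (hi : 0 ≤ i) (hj : 0 ≤ j) (hik : i + k ≤ n)
    (hjk : j + k ≤ n) : blockDet n (genericLam n) (genericMu n)
      (extendEntries (genericMatrix n)) k (i + k - 1) j ≠ 0 := by
  intro h0
  have h := hasValueAt_blockDet (lam := fun _ => (1 : ℚ)) (mu := fun _ => 1)
    (A := Matrix.of fun _ _ => 1) (α := fun _ => 1) (fun _ => one_ne_zero)
    (fun i j => rfl) k (r := i + k - 1) (j := j) (by omega) (by omega) hj hjk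
  rw [h0] at h
  exact (blockDet_pos n k (i + k - 1) j).ne (hasValueAt_zero.unique h)

theorem blockLambdaDet_zero_zero (hα : ∀ i j : Fin n, α (latticePos n i j) = A i j) :
    blockLambdaDet n lam mu α n 0 0 = lambdaDet n lam mu A := by
  simp [blockLambdaDet, blockMatrix_zero_zero hα]

theorem blockDefined_zero_zero (hα : ∀ i j : Fin n, α (latticePos n i j) = A i j) :
    BlockDefined n lam mu α n 0 0 ↔ CondensationDefined n lam mu A := by
  simp [BlockDefined, blockMatrix_zero_zero hα]

theorem lambdaDet_eq_blockDet (hα0 : ∀ v, α v ≠ 0)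
    (hα : ∀ i j : Fin n, α (latticePos n i j) = A i j) (h : CondensationDefined n lam mu A) :
    lambdaDet n lam mu A = blockDet n lam mu α n (n - 1) 0 := by
  have h2 := blockLambdaDet_eq_blockDet (satisfiesOctahedron lam mu hα0 hα) n 0 0 le_rfl le_rfl
    (by simp) (by simp) ((blockDefined_zero_zero hα).mpr h)
  rwa [blockLambdaDet_zero_zero hα, zero_add] at h2

theorem hasValueAt_genericLambdaDet (lam mu : ℤ → K) (hα0 : ∀ v, α v ≠ 0)
    (hα : ∀ i j : Fin n, α (latticePos n i j) = A i j) :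
    HasValueAt (genericLambdaDet n) (lambdaPoint n lam mu A)
      (blockDet n lam mu α n (n - 1) 0) := by
  have hgen := extendEntries_latticePos (genericMatrix n)
  have hdef := (blockDefined_zero_zero hgen).mp
    (blockDefined_of_blockDet_ne_zero (satisfiesOctahedron_generic n)
      (blockDet_generic_ne_zero n) n 0 0 le_rfl le_rfl (by simp) (by simp))
  have h : genericLambdaDet n = blockDet n (genericLam n) (genericMu n)
      (extendEntries (genericMatrix n)) n (n - 1) 0 :=
    lambdaDet_eq_blockDet (genericEntries_ne_zero n) hgen hdef
  rw [h]
  exact hasValueAt_blockDet hα0 hα n (by omega) (by omega) le_rfl (by simp)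

end Specialization

/-! ### Matrix elements as written with powers of the translation operators -/

section Translations

variable (K : Type*) [Field K]

theorem latticeTranslate_zpow (d : ℤ × ℤ) (a : ℤ) :
    latticeTranslate K d ^ a = latticeTranslate K (a • d) := by
  have hadd : ∀ d e : ℤ × ℤ,
      latticeTranslate K d * latticeTranslate K e = latticeTranslate K (d + e) := by
    intro d e
    ext f v
    change f.1 (v - d - e) = f.1 (v - (d + e))
    rw [sub_sub]
  have hzero : latticeTranslate K 0 = 1 := by
    ext f v
    change f.1 (v - 0) = f.1 v
    rw [sub_zero]
  let φ : Multiplicative (ℤ × ℤ) →* (LatticeSpace K ≃ₗ[K] LatticeSpace K) :=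
    { toFun := fun d => latticeTranslate K d.toAdd
      map_one' := hzero
      map_mul' := fun d e => (hadd _ _).symm }
  exact (map_zpow φ (Multiplicative.ofAdd d) a).symm

theorem latticeTranslate_ket (d u : ℤ × ℤ) :
    latticeTranslate K d (ket K u) = ket K (u + d) := by
  ext v
  change (ket K u).1 (v - d) = (ket K (u + d)).1 v
  simp only [ket_apply, eq_sub_iff_add_eq]

theorem zOp_zpow_ket (i : ℤ) :
    (zOp K ^ (1 - (i + 1))) (ket K (0, 0)) = ket K (-i, i) := by
  rw [zOp, latticeTranslate_zpow, latticeTranslate_ket]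
  congr 1
  ext <;> simp

theorem bra_wOp_zpow (j : ℤ) (f : LatticeSpace K) :
    bra K (0, 0) ((wOp K ^ (1 - (j + 1))) f) = f.1 (j, j) := by
  rw [wOp, latticeTranslate_zpow]
  refine congrArg f.1 ?_
  ext <;> simp

end Translations

theorem mainTheorem7 {K : Type*} [Field K] (n : ℕ) (lam mu : ℤ → K)
    (A : Matrix (Fin n) (Fin n) K) (α : ℤ × ℤ → K)
    (hα0 : ∀ v, α v ≠ 0)
    (hα : ∀ i j : Fin n, α ((i : ℤ) + j + 1 - n, (j : ℤ) - i + n - 1) = A i j) :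
    IsUnit (1 - transferOp n lam mu α) ∧
    (∀ i j : Fin n,
      {p | IsNetPath n (-(i : ℤ), (i : ℤ)) ((j : ℤ), (j : ℤ)) p}.Finite ∧
      netPartition n lam mu α (-(i : ℤ), (i : ℤ)) ((j : ℤ), (j : ℤ)) =
        bra K (0, 0) ((wOp K ^ (1 - ((j : ℤ) + 1)))
          (Ring.inverse (1 - transferOp n lam mu α)
            ((zOp K ^ (1 - ((i : ℤ) + 1))) (ket K (0, 0)))))) ∧
    (CondensationDefined n lam mu A →
      lambdaDet n lam mu A =
        (Matrix.of fun i j : Fin n =>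
          bra K (0, 0) ((wOp K ^ (1 - ((j : ℤ) + 1)))
            (diagOp α (Ring.inverse (1 - transferOp n lam mu α)
              ((zOp K ^ (1 - ((i : ℤ) + 1))) (ket K (0, 0))))))).det) ∧
    HasValueAt (genericLambdaDet n) (lambdaPoint n lam mu A)
      (Matrix.of fun i j : Fin n =>
        bra K (0, 0) ((wOp K ^ (1 - ((j : ℤ) + 1)))
          (diagOp α (Ring.inverse (1 - transferOp n lam mu α)
            ((zOp K ^ (1 - ((i : ℤ) + 1))) (ket K (0, 0))))))).det := by
  have hdet : (Matrix.of fun i j : Fin n =>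
      bra K (0, 0) ((wOp K ^ (1 - ((j : ℤ) + 1)))
        (diagOp α (Ring.inverse (1 - transferOp n lam mu α)
          ((zOp K ^ (1 - ((i : ℤ) + 1))) (ket K (0, 0))))))).det =
      blockDet n lam mu α n (n - 1) 0 := by
    rw [blockDet]
    congr 1
    ext i j
    simp only [Matrix.of_apply, zOp_zpow_ket, bra_wOp_zpow, entryGreen]
    have h1 : latticePos n ((n : ℤ) - 1) (0 + (j : ℕ)) = ((j : ℤ), (j : ℤ)) := by
      ext <;> simp only [latticePos] <;> ring
    have h2 : latticePos n ((n : ℤ) - 1 - (i : ℕ)) 0 = (-(i : ℤ), (i : ℤ)) := by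
      ext <;> simp only [latticePos] <;> ring
    rw [h1, h2]
    rfl
  rw [hdet]
  refine ⟨isUnit_one_sub_transferOp n lam mu α, fun i j => ?_, lambdaDet_eq_blockDet hα0 hα,
    hasValueAt_genericLambdaDet lam mu hα0 hα⟩
  have he : ((j : ℤ), (j : ℤ)) ∈ networkVertices n := by
    rw [mem_networkVertices]; have := j.2; dsimp only; omega
  have hu : (-(i : ℤ), (i : ℤ)) ∈ networkVertices n := by
    rw [mem_networkVertices]; have := i.2; dsimp only; omega
  obtain ⟨hfin, hval⟩ := netPartition_eq_green n lam mu α he (-(i : ℤ), (i : ℤ))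
  refine ⟨hfin, ?_⟩
  rw [hval hu, zOp_zpow_ket, bra_wOp_zpow]
  rfl
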